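/- Let $G$ be a compact Lie group with an $\mathrm{Ad}$-invariant inner product on its Lie algebra $\mathfrak g$, and let $\Delta=\sum_k X_kX^k$ be the corresponding Laplacian (quadratic Casimir operator) on $C^\infty(G)$, where $(X_k)$ is a basis of $\mathfrak g$, $(X^k)$ is the dual basis with respect to the inner product, and elements of $\mathfrak g$ act as left-invariant vector fields. An oriented graph $\Lambda$ has a set of vertices $\Lambda^0$ and a finite set of edges $\Lambda^1$ with source and target maps $s,t:\Lambda^1\to\Lambda^0$. Put $\mathcal H_\Lambda=L^2(G^{\Lambda^1})$ with respect to normalized Haar measure. The gauge group $\mathcal G_\Lambda=G^{\Lambda^0}$ acts on $G^{\Lambda^1}$ by $(g\cdot a)_e=g_{s(e)}a_eg_{t(e)}^{-1}$; let $\mathcal H_\Lambda^{\mathcal G_\Lambda}$ be the closed subspace of all $\psi\in\mathcal H_\Lambda$ with $\psi(g\,\cdot)=\psi$ for every $g\in\mathcal G_\Lambda$. For real constants $(I_e)_{e\in\Lambda^1}$ the operator $\sum_{e\in\Lambda^1}-\tfrac12 I_e\Delta_e$ with domain $C^\infty(G^{\Lambda^1})$, where $\Delta_e$ is $\Delta$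 acting in the variable $a_e$, is closable in $\mathcal H_\Lambda$; its closure $H_0$, with domain $\mathrm{Dom}(H_0)$, is the free electric Hamiltonian. Let $\iota$ be a refinement of $\Lambda_i$ by $\Lambda_j$: a functor from the free (path) category generated by $\Lambda_i$ to that generated by $\Lambda_j$ which is injective on vertices and maps each edge $e\in\Lambda_i^1$ to a nontrivial oriented path $\iota(e)=(e_1,\dots,e_n)$ in $\Lambda_j$ with pairwise distinct edges, such that $\iota(e)$ and $\iota(e')$ have no common edge when $e\ne e'$. Let $R:G^{\Lambda_j^1}\to G^{\Lambda_i^1}$, $R(a)_e=a_{e_1}\cdots a_{e_n}$, and let $u:\mathcal H_i\to\mathcal H_j$, $u\psi=\psi\circ R$, which is an isometry that maps $\mathcal H_i^{\mathcal G_i}$ into $\mathcal H_j^{\mathcal G_j}$; let $u_{\mathrm{red}}:\mathcal H_i^{\mathcal G_i}\to\mathcal H_j^{\mathcal G_j}$ be its restriction. Let $H_{0,i}$ and $H_{0,j}$ be the free electric Hamiltonians for constants $(I_{i,e})_{e\in\Lambda_i^1}$ and $(I_{j,e})_{e\in\Lambda_j^1}$, and suppose that for each $e\in\Lambda_i^1$,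 with $\iota(e)=(e_1,\dots,e_n)$, $$I_{i,e}=\sum_{k=1}^n I_{j,e_k}.$$ Then: 1. $u(\mathrm{Dom}(H_{0,i}))\subseteq\mathrm{Dom}(H_{0,j})$, and $H_{0,j}u\psi=uH_{0,i}\psi$ for all $\psi\in\mathrm{Dom}(H_{0,i})$. 2. The restrictions $H_{0,i}^{\mathrm{red}}$ and $H_{0,j}^{\mathrm{red}}$ of $H_{0,i}$ and $H_{0,j}$ to $\mathrm{Dom}(H_{0,i})\cap\mathcal H_i^{\mathcal G_i}$ and $\mathrm{Dom}(H_{0,j})\cap\mathcal H_j^{\mathcal G_j}$ take values in $\mathcal H_i^{\mathcal G_i}$ and $\mathcal H_j^{\mathcal G_j}$, respectively; $u(\mathrm{Dom}(H_{0,i})\cap\mathcal H_i^{\mathcal G_i})\subseteq\mathrm{Dom}(H_{0,j})\cap\mathcal H_j^{\mathcal G_j}$; and $H_{0,j}^{\mathrm{red}}u_{\mathrm{red}}\psi=u_{\mathrm{red}}H_{0,i}^{\mathrm{red}}\psi$ for all $\psi\in\mathrm{Dom}(H_{0,i})\cap\mathcal H_i^{\mathcal G_i}$. -/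

import Mathlib

open MeasureTheory CategoryTheory
open scoped Manifold ContDiff ENNReal

noncomputable section

namespace LatticeGauge

/-! ### Oriented graphs and refinements

An oriented graph is a quiver `V`: the vertices are the points of `V`, the edges are the elements
of `Quiver.Total V`, and the source and target of an edge `e` are `e.left` and `e.right`.
The free category generated by the graph is `CategoryTheory.Paths V`. -/

section Graph

/-- The list `(e₁, …, eₙ)` of the edges of a path, in the order in which they are traversed. -/
def pathEdges {V : Type*} [Quiver V] : {x y : V} → Quiver.Path x y → List (Quiver.Total V)
  | _, _, .nil => []
  | _, _, .cons p e => pathEdges p ++ [⟨_, _, e⟩]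

/-- The edges of the path to which a functor between free categories sends the edge `e`. -/
def imageEdges {V W : Type*} [Quiver V] [Quiver W] (F : Paths V ⥤ Paths W) (e : Quiver.Total V) :
    List (Quiver.Total W) :=
  pathEdges (V := W) (F.map ((Paths.of V).map e.hom))

/-- A refinement of the graph `V` by the graph `W`: a functor between the free categories that is
injective on vertices, sends each edge to a nontrivial path that runs through no edge twice, and
sends distinct edges to paths without common edges. -/
structure Refinement (V W : Type*) [Quiver V] [Quiver W] where
  functor : Paths V ⥤ Paths W
  obj_injective : Function.Injective functor.obj
  edges_ne_nil : ∀ e, imageEdges functor e ≠ []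
  edges_nodup : ∀ e, (imageEdges functor e).Nodup
  edges_disjoint : ∀ e e', e ≠ e' → (imageEdges functor e).Disjoint (imageEdges functor e')

/-- The path `(e₁, …, eₙ)` into which the edge `e` is refined. -/
def Refinement.path {V W : Type*} [Quiver V] [Quiver W] (r : Refinement V W) (e : Quiver.Total V) :
    List (Quiver.Total W) :=
  imageEdges r.functor e

/-- The action of the gauge group `G ^ vertices` on the configuration space `G ^ edges`. -/
def gaugeAct {V : Type*} [Quiver V] {G : Type*} [Group G] (g : V → G) (a : Quiver.Total V → G) :
    Quiver.Total V → G :=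
  fun e => g e.left * a e * (g e.right)⁻¹

/-- The map of configuration spaces `R(a)_e = a_{e₁} ⋯ a_{eₙ}` induced by a refinement. -/
def Refinement.config {V W : Type*} [Quiver V] [Quiver W] (r : Refinement V W)
    {G : Type*} [Group G] (a : Quiver.Total W → G) : Quiver.Total V → G :=
  fun e => ((r.path e).map a).prod

/-- The homomorphism of gauge groups induced by a refinement. -/
def Refinement.gauge {V W : Type*} [Quiver V] [Quiver W] (r : Refinement V W)
    {G : Type*} (g : W → G) : V → G :=
  fun x => g (r.functor.obj x)

lemma prod_pathEdges_gaugeAct {V : Type*} [Quiver V] {G : Type*} [Group G] (g : V → G)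
    (a : Quiver.Total V → G) {x y : V} (p : Quiver.Path x y) :
    ((pathEdges p).map (gaugeAct g a)).prod = g x * ((pathEdges p).map a).prod * (g y)⁻¹ := by
  induction p with
  | nil => simp [pathEdges]
  | cons p e ih => simp [pathEdges, ih, gaugeAct, mul_assoc]

lemma Refinement.config_gaugeAct {V W : Type*} [Quiver V] [Quiver W] (r : Refinement V W)
    {G : Type*} [Group G] (g : W → G) (a : Quiver.Total W → G) :
    r.config (gaugeAct g a) = gaugeAct (r.gauge g) (r.config a) := by
  funext e
  exact prod_pathEdges_gaugeAct g a _

end Graph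

/-! ### The product manifold `G ^ ι` -/

section Smooth

variable {ι : Type*} [Fintype ι]
  {E : Type*} [NormedAddCommGroup E] [NormedSpace ℝ E]
  {G : Type*} [TopologicalSpace G] [ChartedSpace E G]

/-- The model of the product manifold `ι → G`, for `G` modelled on `E`. -/
abbrev configModel (ι : Type*) [Fintype ι] (E : Type*) [NormedAddCommGroup E] [NormedSpace ℝ E] :
    ModelWithCorners ℝ (ι → E) (ModelPi fun _ : ι => E) :=
  ModelWithCorners.pi fun _ : ι => 𝓘(ℝ, E)

lemma contMDiff_eval (n : WithTop ℕ∞) (e : ι) :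
    ContMDiff (configModel ι E) 𝓘(ℝ, E) n (fun a : ι → G => a e) := by
  intro a
  rw [contMDiffAt_iff]
  refine ⟨(continuous_apply e).continuousAt, ?_⟩
  have h : ContDiffAt ℝ n (fun v : ι → E => v e) (extChartAt (configModel ι E) a a) :=
    (contDiff_apply ℝ E e).contDiffAt
  refine h.contDiffWithinAt.congr_of_eventuallyEq ?_ ?_
  · have ho := extChartAt_target_mem_nhdsWithin (I := configModel ι E) a
    filter_upwards [ho] with v hv
    have := (extChartAt (configModel ι E) a).right_inv hv
    exact congrFun this e
  · have := (extChartAt (configModel ι E) a).left_inv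
      (mem_extChartAt_source (I := configModel ι E) a)
    simp only [Function.comp_apply, this]
    rfl

lemma contMDiff_into_config {F H M : Type*} [NormedAddCommGroup F] [NormedSpace ℝ F]
    [TopologicalSpace H] {I : ModelWithCorners ℝ F H} [TopologicalSpace M] [ChartedSpace H M]
    {n : WithTop ℕ∞} {f : M → ι → G} (hf : ∀ e, ContMDiff I 𝓘(ℝ, E) n fun x => f x e) :
    ContMDiff I (configModel ι E) n f := by
  intro x
  rw [contMDiffAt_iff]
  refine ⟨continuousAt_pi.2 fun e => (hf e x).continuousAt, ?_⟩
  exact contDiffWithinAt_pi.2 fun e => (contMDiffAt_iff.1 (hf e x)).2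

instance isManifold_config (n : WithTop ℕ∞) [IsManifold 𝓘(ℝ, E) n G] :
    IsManifold (configModel ι E) n (ι → G) := by
  apply isManifold_of_contDiffOn
  rintro _ _ ⟨c, hc, rfl⟩ ⟨c', hc', rfl⟩
  refine contDiffOn_pi.2 fun e => ?_
  have h := (contDiffGroupoid n 𝓘(ℝ, E)).compatible (hc e trivial) (hc' e trivial)
  rw [contDiffGroupoid, mem_groupoid_of_pregroupoid] at h
  refine ContDiffOn.comp (t := _) (g := _) (f := fun v : ι → E => v e) h.1
    (contDiff_apply ℝ E e).contDiffOn ?_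
  rintro v ⟨hv, -⟩
  exact ⟨⟨hv.1 e trivial, hv.2 e trivial⟩, Set.mem_range_self _⟩

open Classical in
lemma smooth_slice (e : ι) {f : (ι → G) → ℂ}
    (hf : ContMDiff (configModel ι E) 𝓘(ℝ, ℂ) ∞ f) (a : ι → G) :
    ContMDiff 𝓘(ℝ, E) 𝓘(ℝ, ℂ) ∞ (fun g => f (Function.update a e g)) := by
  refine hf.comp (contMDiff_into_config fun e' => ?_)
  by_cases h : e' = e
  · subst h; simp only [Function.update_self]; exact contMDiff_id
  · simpa [h] using contMDiff_const

variable (ι E G) in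
/-- The space `C^∞(G ^ ι)` of smooth complex functions on the configuration space. -/
def smoothFunctions : Submodule ℂ ((ι → G) → ℂ) where
  carrier := {f | ContMDiff (configModel ι E) 𝓘(ℝ, ℂ) ∞ f}
  add_mem' := fun hf hg => hf.add hg
  zero_mem' := contMDiff_const
  smul_mem' := fun c _ hf => (contDiff_const_smul c (n := ∞) (𝕜 := ℝ) (F := ℂ)).contMDiff.comp hf

end Smooth

/-! ### The Laplacian of a Lie group with an invariant metric -/

section Laplacian

variable {E : Type*} [NormedAddCommGroup E] [NormedSpace ℝ E]
  {G : Type*} [TopologicalSpace G] [ChartedSpace E G] [Group G]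

variable (E) in
/-- The adjoint representation: `Ad g` is the derivative at `1` of `h ↦ g h g⁻¹`. (This derivative
takes values in the tangent space at `g 1 g⁻¹`, which is the point `1`.) -/
def Ad (g : G) : GroupLieAlgebra 𝓘(ℝ, E) G →L[ℝ] GroupLieAlgebra 𝓘(ℝ, E) G :=
  mfderiv 𝓘(ℝ, E) 𝓘(ℝ, E) (fun h : G => g * h * g⁻¹) 1

variable (E G) in
/-- An `Ad`-invariant inner product on the Lie algebra of `G`; this is the same as a bi-invariant
Riemannian metric on `G`. -/
structure InvariantInner where
  form : LinearMap.BilinForm ℝ (GroupLieAlgebra 𝓘(ℝ, E) G)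
  symm : ∀ X Y, form X Y = form Y X
  pos : ∀ X, X ≠ 0 → 0 < form X X
  ad_invariant : ∀ (g : G) (X Y), form (Ad E g X) (Ad E g Y) = form X Y

lemma InvariantInner.nondegenerate (B : InvariantInner E G) : B.form.Nondegenerate := by
  constructor
  · intro X h
    by_contra hX
    exact (B.pos X hX).ne' (h X)
  · intro X h
    by_contra hX
    exact (B.pos X hX).ne' (h X)

/-- The derivative of `φ : G → ℂ` along the left invariant vector field of `X`. -/
def lieDeriv (X : GroupLieAlgebra 𝓘(ℝ, E) G) (φ : G → ℂ) (g : G) : ℂ :=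
  mfderiv 𝓘(ℝ, E) 𝓘(ℝ, ℂ) φ g (mulInvariantVectorField X g)

open Classical in
/-- The derivative of `f : G ^ ι → ℂ` along the left invariant vector field of `X` in the
variable `e`. -/
def edgeDeriv {ι : Type*} (e : ι) (X : GroupLieAlgebra 𝓘(ℝ, E) G) (f : (ι → G) → ℂ)
    (a : ι → G) : ℂ :=
  lieDeriv X (fun g => f (Function.update a e g)) (a e)

instance finiteDimensional_lieAlgebra [FiniteDimensional ℝ E] :
    FiniteDimensional ℝ (GroupLieAlgebra 𝓘(ℝ, E) G) :=
  inferInstanceAs (FiniteDimensional ℝ E)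

/-- The Laplacian of `G`, i.e. the differential operator `∑ₖ Xₖ X^k` of the quadratic Casimir
element, where `(X_k)` is a basis of the Lie algebra and `(X^k)` is the dual basis with respect to
the invariant inner product (the operator does not depend on the basis). -/
def laplacian [FiniteDimensional ℝ E] (B : InvariantInner E G) (φ : G → ℂ) (g : G) : ℂ :=
  let b := Module.finBasis ℝ (GroupLieAlgebra 𝓘(ℝ, E) G)
  let b' := B.form.dualBasis B.nondegenerate b
  ∑ k, lieDeriv (b k) (lieDeriv (b' k) φ) g

open Classical in
/-- The Laplacian `Δ_e`, acting in the variable `e`. -/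
def edgeLaplacian [FiniteDimensional ℝ E] {ι : Type*} (B : InvariantInner E G) (e : ι)
    (f : (ι → G) → ℂ) (a : ι → G) : ℂ :=
  laplacian B (fun g => f (Function.update a e g)) (a e)

/-- The differential operator `∑_e -(1/2) I_e Δ_e`. -/
def electricOp [FiniteDimensional ℝ E] {ι : Type*} [Fintype ι] (B : InvariantInner E G)
    (c : ι → ℝ) (f : (ι → G) → ℂ) (a : ι → G) : ℂ :=
  ∑ e, -(1 / 2 : ℂ) * (c e : ℂ) * edgeLaplacian B e f a

open Classical in
lemma edgeDeriv_update {ι : Type*} (e : ι) (X : GroupLieAlgebra 𝓘(ℝ, E) G) (f : (ι → G) → ℂ)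
    (a : ι → G) (g : G) :
    edgeDeriv e X f (Function.update a e g) =
      lieDeriv X (fun g => f (Function.update a e g)) g := by
  simp [edgeDeriv]

lemma edgeLaplacian_eq [FiniteDimensional ℝ E] {ι : Type*} (B : InvariantInner E G) (e : ι)
    (f : (ι → G) → ℂ) :
    edgeLaplacian B e f = fun a =>
      let b := Module.finBasis ℝ (GroupLieAlgebra 𝓘(ℝ, E) G)
      let b' := B.form.dualBasis B.nondegenerate b
      ∑ k, edgeDeriv e (b k) (edgeDeriv e (b' k) f) a := by
  funext a
  simp only [edgeLaplacian, laplacian]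
  refine Finset.sum_congr rfl fun k _ => ?_
  conv_rhs => rw [edgeDeriv]
  simp only [edgeDeriv_update]

lemma lieDeriv_add (X : GroupLieAlgebra 𝓘(ℝ, E) G) {φ ψ : G → ℂ} {g : G}
    (hφ : MDifferentiableAt 𝓘(ℝ, E) 𝓘(ℝ, ℂ) φ g) (hψ : MDifferentiableAt 𝓘(ℝ, E) 𝓘(ℝ, ℂ) ψ g) :
    lieDeriv X (φ + ψ) g = lieDeriv X φ g + lieDeriv X ψ g := by
  have := (hφ.hasMFDerivAt.add hψ.hasMFDerivAt).mfderiv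
  simp only [lieDeriv]
  rw [this]
  rfl

lemma lieDeriv_smul (X : GroupLieAlgebra 𝓘(ℝ, E) G) (c : ℂ) {φ : G → ℂ} {g : G}
    (hφ : MDifferentiableAt 𝓘(ℝ, E) 𝓘(ℝ, ℂ) φ g) :
    lieDeriv X (c • φ) g = c • lieDeriv X φ g := by
  have := (((ContinuousLinearMap.mul ℝ ℂ c).hasMFDerivAt (x := φ g)).comp g
    hφ.hasMFDerivAt).mfderiv
  simp only [lieDeriv]
  change mfderiv 𝓘(ℝ, E) 𝓘(ℝ, ℂ) (c • φ) g = _ at this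
  rw [this]
  rfl

lemma edgeDeriv_add {ι : Type*} [Fintype ι] (e : ι) (X : GroupLieAlgebra 𝓘(ℝ, E) G)
    {f h : (ι → G) → ℂ} (hf : f ∈ smoothFunctions ι E G) (hh : h ∈ smoothFunctions ι E G) :
    edgeDeriv e X (f + h) = edgeDeriv e X f + edgeDeriv e X h := by
  funext a
  exact lieDeriv_add X ((smooth_slice e hf a).mdifferentiable (by simp) _)
    ((smooth_slice e hh a).mdifferentiable (by simp) _)

lemma edgeDeriv_smul {ι : Type*} [Fintype ι] (e : ι) (X : GroupLieAlgebra 𝓘(ℝ, E) G) (c : ℂ)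
    {f : (ι → G) → ℂ} (hf : f ∈ smoothFunctions ι E G) :
    edgeDeriv e X (c • f) = c • edgeDeriv e X f := by
  funext a
  exact lieDeriv_smul X c ((smooth_slice e hf a).mdifferentiable (by simp) _)

variable {ι : Type*} [Fintype ι] [LieGroup 𝓘(ℝ, E) ∞ G]

open Classical in
lemma edgeDeriv_eq (e : ι) (X : GroupLieAlgebra 𝓘(ℝ, E) G) {f : (ι → G) → ℂ}
    (hf : f ∈ smoothFunctions ι E G) (a : ι → G) :
    edgeDeriv e X f a =
      mfderiv 𝓘(ℝ, E) 𝓘(ℝ, ℂ) (fun g => f (Function.update a e (a e * g))) 1 X := by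
  have h1 : MDifferentiableAt 𝓘(ℝ, E) 𝓘(ℝ, ℂ) (fun g => f (Function.update a e g)) (a e * 1) :=
    (smooth_slice e hf a).mdifferentiable (by simp) _
  have h2 : MDifferentiableAt 𝓘(ℝ, E) 𝓘(ℝ, E) (fun g : G => a e * g) 1 :=
    (contMDiff_mul_left (I := 𝓘(ℝ, E)) (n := ∞)).mdifferentiable (by simp) _
  have := mfderiv_comp (1 : G) h1 h2
  change mfderiv 𝓘(ℝ, E) 𝓘(ℝ, ℂ) (fun g => f (Function.update a e (a e * g))) 1 = _ at this
  rw [this]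
  change mfderiv 𝓘(ℝ, E) 𝓘(ℝ, ℂ) (fun g => f (Function.update a e g)) (a e) _ =
    mfderiv 𝓘(ℝ, E) 𝓘(ℝ, ℂ) (fun g => f (Function.update a e g)) (a e * 1) _
  rw [mul_one]
  rfl

open Classical in
lemma smooth_edgeDeriv (e : ι) (X : GroupLieAlgebra 𝓘(ℝ, E) G) {f : (ι → G) → ℂ}
    (hf : f ∈ smoothFunctions ι E G) : edgeDeriv e X f ∈ smoothFunctions ι E G := by
  intro a
  have hM : IsManifold 𝓘(ℝ, E) 1 G := IsManifold.of_le (n := ∞) (m := 1) (by simp)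
  have hF : ContMDiff ((configModel ι E).prod 𝓘(ℝ, E)) 𝓘(ℝ, ℂ) ∞
      (Function.uncurry fun (a : ι → G) (g : G) => f (Function.update a e (a e * g))) := by
    refine ContMDiff.comp (I' := configModel ι E) hf (contMDiff_into_config fun e' => ?_)
    by_cases h : e' = e
    · subst h
      have h0 : ContMDiff ((configModel ι E).prod 𝓘(ℝ, E)) 𝓘(ℝ, E) ∞
          (fun p : (ι → G) × G => p.1 e' * p.2) :=
        ((contMDiff_eval ∞ e').comp contMDiff_fst).mul contMDiff_snd
      simpa using h0
    · have h0 : ContMDiff ((configModel ι E).prod 𝓘(ℝ, E)) 𝓘(ℝ, E) ∞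
          (fun p : (ι → G) × G => p.1 e') := (contMDiff_eval ∞ e').comp contMDiff_fst
      simpa [h] using h0
  have h := ContMDiffAt.mfderiv (x₀ := a) (m := ∞) (n := ∞)
    (fun (a : ι → G) (g : G) => f (Function.update a e (a e * g))) (fun _ => 1)
    (hF _) contMDiffAt_const (by simp)
  let D : (ι → G) → E →L[ℝ] ℂ := fun b =>
    mfderiv 𝓘(ℝ, E) 𝓘(ℝ, ℂ) (fun g => f (Function.update b e (b e * g))) 1
  have hD : ContMDiffAt (configModel ι E) 𝓘(ℝ, E →L[ℝ] ℂ) ∞ D a := by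
    refine h.congr_of_eventuallyEq (Filter.Eventually.of_forall fun b => ?_)
    rw [inTangentCoordinates_eq (I := 𝓘(ℝ, E)) (I' := 𝓘(ℝ, ℂ)) (M := G) (M' := ℂ)
      (fun _ => 1) _ D (mem_chart_source E (1 : G)) (Set.mem_univ _)]
    ext v
    have h1 : (tangentBundleCore 𝓘(ℝ, E) G).coordChange (achart E (1 : G)) (achart E (1 : G)) 1 v
        = v := (tangentBundleCore 𝓘(ℝ, E) G).coordChange_self _ _ (mem_chart_source E (1 : G)) _
    simp only [ContinuousLinearMap.comp_apply, h1, tangentBundleCore_coordChange_model_space]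
    rfl
  have hX : ContMDiffAt (configModel ι E) 𝓘(ℝ, ℂ) ∞ (fun b => D b (show E from X)) a :=
    hD.clm_apply contMDiffAt_const
  exact hX.congr_of_eventuallyEq (Filter.Eventually.of_forall fun b => edgeDeriv_eq e X hf b)

lemma smooth_electricOp [FiniteDimensional ℝ E] (B : InvariantInner E G) (c : ι → ℝ)
    {f : (ι → G) → ℂ} (hf : f ∈ smoothFunctions ι E G) :
    electricOp B c f ∈ smoothFunctions ι E G := by
  have : electricOp B c f = ∑ e, (-(1 / 2 : ℂ) * (c e : ℂ)) • edgeLaplacian B e f := by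
    funext a
    simp [electricOp]
  rw [this]
  refine Submodule.sum_mem _ fun e _ => Submodule.smul_mem _ _ ?_
  rw [edgeLaplacian_eq]
  have h2 : ∀ k, edgeDeriv e (Module.finBasis ℝ (GroupLieAlgebra 𝓘(ℝ, E) G) k) (edgeDeriv e
      (B.form.dualBasis B.nondegenerate (Module.finBasis ℝ (GroupLieAlgebra 𝓘(ℝ, E) G)) k) f) ∈
      smoothFunctions ι E G := fun k => smooth_edgeDeriv e _ (smooth_edgeDeriv e _ hf)
  convert Submodule.sum_mem _ (fun k (_ : k ∈ Finset.univ) => h2 k) using 1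
  funext a
  simp

/-- The operator `∑_e -(1/2) I_e Δ_e` on the space of smooth functions. -/
def electricMap [FiniteDimensional ℝ E] (B : InvariantInner E G) (c : ι → ℝ) :
    smoothFunctions ι E G →ₗ[ℂ] smoothFunctions ι E G where
  toFun f := ⟨electricOp B c f, smooth_electricOp B c f.2⟩
  map_add' f h := by
    ext a
    simp only [electricOp, edgeLaplacian_eq, Submodule.coe_add, Pi.add_apply]
    rw [← Finset.sum_add_distrib]
    refine Finset.sum_congr rfl fun e _ => ?_
    rw [← mul_add, ← Finset.sum_add_distrib]
    refine congrArg _ (Finset.sum_congr rfl fun k _ => ?_)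
    rw [edgeDeriv_add e _ f.2 h.2,
      edgeDeriv_add e _ (smooth_edgeDeriv e _ f.2) (smooth_edgeDeriv e _ h.2)]
    rfl
  map_smul' z f := by
    ext a
    simp only [electricOp, edgeLaplacian_eq, Submodule.coe_smul, Pi.smul_apply, smul_eq_mul,
      RingHom.id_apply]
    rw [Finset.mul_sum]
    refine Finset.sum_congr rfl fun e _ => ?_
    conv_rhs => rw [mul_left_comm, Finset.mul_sum]
    refine congrArg _ (Finset.sum_congr rfl fun k _ => ?_)
    rw [edgeDeriv_smul e _ z f.2, edgeDeriv_smul e _ z (smooth_edgeDeriv e _ f.2)]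
    rfl

end Laplacian

/-! ### The Hilbert spaces -/

section HilbertSpace

section Measure

variable (G : Type*) [Group G] [TopologicalSpace G] [IsTopologicalGroup G]
  [CompactSpace G] [MeasurableSpace G] [BorelSpace G]

/-- The normalized Haar measure of the compact group `G`. -/
def haarProb : Measure G := Measure.haarMeasure ⊤

instance haarProb_isHaarMeasure : (haarProb G).IsHaarMeasure :=
  inferInstanceAs (Measure.haarMeasure ⊤).IsHaarMeasure

instance haarProb_isProbabilityMeasure : IsProbabilityMeasure (haarProb G) :=
  ⟨by simpa [haarProb] using
    Measure.haarMeasure_self (K₀ := (⊤ : TopologicalSpace.PositiveCompacts G))⟩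

instance haarProb_isMulRightInvariant : (haarProb G).IsMulRightInvariant where
  map_mul_right_eq_self g := by
    have : IsProbabilityMeasure ((haarProb G).map (· * g)) :=
      Measure.isProbabilityMeasure_map (measurable_mul_const g).aemeasurable
    have : ((haarProb G).map (· * g)).IsHaarMeasure :=
      Measure.isHaarMeasure_of_isCompact_nonempty_interior _ Set.univ isCompact_univ
        (by simp) (by simp) (by simp)
    exact Measure.isHaarMeasure_eq_of_isProbabilityMeasure _ _

/-- The normalized Haar measure of the configuration space `G ^ ι`: the product measure. -/
def configMeasure (ι : Type*) [Fintype ι] : Measure (ι → G) := Measure.pi fun _ => haarProb G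

instance configMeasure_isProbabilityMeasure (ι : Type*) [Fintype ι] :
    IsProbabilityMeasure (configMeasure G ι) :=
  inferInstanceAs (IsProbabilityMeasure (Measure.pi fun _ : ι => haarProb G))

instance configMeasure_isHaarMeasure [SecondCountableTopology G] (ι : Type*) [Fintype ι] :
    (configMeasure G ι).IsHaarMeasure :=
  inferInstanceAs (Measure.pi fun _ : ι => haarProb G).IsHaarMeasure

/-- The Hilbert space `L²(G ^ ι)`. -/
abbrev L2 (ι : Type*) [Fintype ι] : Type _ := Lp ℂ 2 (configMeasure G ι)

end Measure

variable {V W : Type*} [Quiver V] [Quiver W]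
  [Fintype (Quiver.Total V)] [Fintype (Quiver.Total W)]
  {G : Type*} [Group G] [TopologicalSpace G] [IsTopologicalGroup G]
  [CompactSpace G] [MeasurableSpace G] [BorelSpace G] [SecondCountableTopology G]

lemma measurePreserving_gaugeAct (g : V → G) :
    MeasurePreserving (gaugeAct g) (configMeasure G (Quiver.Total V))
      (configMeasure G (Quiver.Total V)) :=
  measurePreserving_pi (fun _ : Quiver.Total V => haarProb G) (fun _ => haarProb G)
    (f := fun e x => g e.left * x * (g e.right)⁻¹) fun e =>
    (measurePreserving_mul_right (haarProb G) (g e.right)⁻¹).comp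
      (measurePreserving_mul_left (haarProb G) (g e.left))

/-- The unitary operator `U(g) ψ = ψ ∘ (g · )` of a gauge transformation. -/
def gaugeOp (g : V → G) : L2 G (Quiver.Total V) →ₗᵢ[ℂ] L2 G (Quiver.Total V) :=
  Lp.compMeasurePreservingₗᵢ ℂ (gaugeAct g) (measurePreserving_gaugeAct g)

variable (V G) in
/-- The subspace of gauge invariant vectors. -/
def gaugeInvariant : Submodule ℂ (L2 G (Quiver.Total V)) :=
  ⨅ g : V → G, LinearMap.eqLocus (gaugeOp g).toLinearMap LinearMap.id

lemma mem_gaugeInvariant {ψ : L2 G (Quiver.Total V)} :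
    ψ ∈ gaugeInvariant V G ↔ ∀ g : V → G, gaugeOp g ψ = ψ := by
  simp [gaugeInvariant, Submodule.mem_iInf, LinearMap.mem_eqLocus]

lemma Refinement.measurePreserving_config (r : Refinement V W) :
    MeasurePreserving (r.config (G := G)) (configMeasure G (Quiver.Total W))
      (configMeasure G (Quiver.Total V)) := by
  classical
  have hc : Continuous (r.config (G := G)) :=
    continuous_pi fun e => continuous_list_prod _ fun x _ => continuous_apply x
  refine ⟨hc.measurable, ?_⟩
  have hinv : ((configMeasure G (Quiver.Total W)).map (r.config (G := G))).IsMulLeftInvariant := by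
    refine ⟨fun h => ?_⟩
    let k : Quiver.Total W → G := fun x =>
      if hx : ∃ e, (r.path e).head? = some x then h hx.choose else 1
    have hk : ∀ a, r.config (k * a) = h * r.config a := by
      intro a
      funext e
      obtain ⟨x, l, hl⟩ := List.exists_cons_of_ne_nil (r.edges_ne_nil e)
      have hl' : r.path e = x :: l := hl
      have hmem : ∀ e' y, (r.path e').head? = some y → y ∈ r.path e → e' = e := by
        intro e' y h1 h2
        by_contra hne
        exact r.edges_disjoint e' e hne (List.mem_of_head? h1) h2
      have h1 : k x = h e := by
        have hx : ∃ e, (r.path e).head? = some x := ⟨e, by simp [hl']⟩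
        have := hmem _ x hx.choose_spec (by simp [hl'])
        simp only [k, dif_pos hx, this]
      have h2 : ∀ y ∈ l, k y = 1 := by
        intro y hy
        refine dif_neg ?_
        rintro ⟨e', he'⟩
        obtain rfl := hmem e' y he' (by simp [hl', hy])
        have hxy : x = y := by simpa [hl'] using he'
        have hnd : (r.path e').Nodup := r.edges_nodup e'
        rw [hl', List.nodup_cons] at hnd
        exact hnd.1 (hxy ▸ hy)
      have h3 : l.map (k * a) = l.map a :=
        List.map_congr_left fun y hy => by simp [h2 y hy]
      simp [Refinement.config, hl', h1, h3, mul_assoc]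
    rw [Measure.map_map (measurable_const_mul h) hc.measurable]
    have : (fun x => h * x) ∘ r.config (G := G) = r.config (G := G) ∘ fun a => k * a := by
      funext a
      exact (hk a).symm
    rw [this, ← Measure.map_map hc.measurable (measurable_const_mul k), map_mul_left_eq_self]
  have hp : IsProbabilityMeasure ((configMeasure G (Quiver.Total W)).map (r.config (G := G))) :=
    Measure.isProbabilityMeasure_map hc.measurable.aemeasurable
  have hH : ((configMeasure G (Quiver.Total W)).map (r.config (G := G))).IsHaarMeasure :=
    Measure.isHaarMeasure_of_isCompact_nonempty_interior _ Set.univ isCompact_univ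
      (by simp) (by simp) (by simp)
  exact Measure.isHaarMeasure_eq_of_isProbabilityMeasure _ _

/-- The isometry `u ψ = ψ ∘ R` induced by a refinement. -/
def Refinement.u (r : Refinement V W) (G : Type*) [Group G] [TopologicalSpace G]
    [IsTopologicalGroup G] [CompactSpace G] [MeasurableSpace G] [BorelSpace G]
    [SecondCountableTopology G] : L2 G (Quiver.Total V) →ₗᵢ[ℂ] L2 G (Quiver.Total W) :=
  Lp.compMeasurePreservingₗᵢ ℂ r.config r.measurePreserving_config

lemma Refinement.u_mem_gaugeInvariant (r : Refinement V W) {ψ : L2 G (Quiver.Total V)}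
    (hψ : ψ ∈ gaugeInvariant V G) : r.u G ψ ∈ gaugeInvariant W G := by
  rw [mem_gaugeInvariant] at hψ ⊢
  intro g
  refine Eq.trans ?_ (congrArg (r.u G) (hψ (r.gauge g)))
  apply Lp.ext
  have hR := r.measurePreserving_config (G := G)
  have h1 : gaugeOp g (r.u G ψ) =ᵐ[configMeasure G (Quiver.Total W)] r.u G ψ ∘ gaugeAct g :=
    Lp.coeFn_compMeasurePreserving _ (measurePreserving_gaugeAct g)
  have h2 : r.u G ψ ∘ gaugeAct g =ᵐ[configMeasure G (Quiver.Total W)]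
      (ψ ∘ r.config) ∘ gaugeAct g :=
    (measurePreserving_gaugeAct g).quasiMeasurePreserving.ae_eq_comp
      (Lp.coeFn_compMeasurePreserving _ hR)
  have h3 : r.u G (gaugeOp (r.gauge g) ψ) =ᵐ[configMeasure G (Quiver.Total W)]
      gaugeOp (r.gauge g) ψ ∘ r.config := Lp.coeFn_compMeasurePreserving _ hR
  have h4 : gaugeOp (r.gauge g) ψ ∘ r.config =ᵐ[configMeasure G (Quiver.Total W)]
      (ψ ∘ gaugeAct (r.gauge g)) ∘ r.config :=
    hR.quasiMeasurePreserving.ae_eq_comp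
      (Lp.coeFn_compMeasurePreserving _ (measurePreserving_gaugeAct (r.gauge g)))
  refine (h1.trans h2).trans (Filter.EventuallyEq.trans ?_ (h3.trans h4).symm)
  refine Filter.Eventually.of_forall fun a => ?_
  simp [r.config_gaugeAct]

/-- The restriction of the isometry `u` to the gauge invariant subspaces. -/
def Refinement.uRed (r : Refinement V W) (G : Type*) [Group G] [TopologicalSpace G]
    [IsTopologicalGroup G] [CompactSpace G] [MeasurableSpace G] [BorelSpace G]
    [SecondCountableTopology G] : gaugeInvariant V G →ₗᵢ[ℂ] gaugeInvariant W G where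
  toLinearMap := (r.u G).toLinearMap.restrict fun _ hψ => r.u_mem_gaugeInvariant hψ
  norm_map' ψ := (r.u G).norm_map ψ

end HilbertSpace

/-! ### The free electric Hamiltonian -/

section Hamiltonian

variable {ι : Type*} [Fintype ι]
  {E : Type*} [NormedAddCommGroup E] [NormedSpace ℝ E]
  {G : Type*} [TopologicalSpace G] [ChartedSpace E G] [Group G] [IsTopologicalGroup G]
  [CompactSpace G] [MeasurableSpace G] [BorelSpace G] [SecondCountableTopology G]

variable (ι E G) in
/-- The inclusion of the space of smooth functions into the Hilbert space. -/
def smoothToL2 : smoothFunctions ι E G →ₗ[ℂ] L2 G ι :=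
  (ContinuousMap.toLp 2 (configMeasure G ι) ℂ).toLinearMap ∘ₗ
    { toFun := fun f => (⟨f, (show ContMDiff (configModel ι E) 𝓘(ℝ, ℂ) ∞ f.1 from f.2).continuous⟩ :
        C(ι → G, ℂ))
      map_add' := fun _ _ => rfl
      map_smul' := fun _ _ => rfl }

lemma smoothToL2_injective : Function.Injective (smoothToL2 ι E G) := by
  refine (ContinuousMap.toLp_injective (configMeasure G ι)).comp fun f h hfh => ?_
  exact Subtype.ext (congrArg (fun k : C(ι → G, ℂ) => (k : (ι → G) → ℂ)) hfh)

variable [FiniteDimensional ℝ E] [LieGroup 𝓘(ℝ, E) ∞ G]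

/-- The operator `∑_e -(1/2) I_e Δ_e` on the Hilbert space, with the smooth functions as domain. -/
def smoothHamiltonian (B : InvariantInner E G) (c : ι → ℝ) : L2 G ι →ₗ.[ℂ] L2 G ι where
  domain := LinearMap.range (smoothToL2 ι E G)
  toFun := smoothToL2 ι E G ∘ₗ electricMap B c ∘ₗ
    (LinearEquiv.ofInjective (smoothToL2 ι E G) smoothToL2_injective).symm.toLinearMap

/-- The free electric Hamiltonian `H₀`: the closure of `∑_e -(1/2) I_e Δ_e` on smooth functions. -/
def hamiltonian (B : InvariantInner E G) (c : ι → ℝ) : L2 G ι →ₗ.[ℂ] L2 G ι :=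
  (smoothHamiltonian B c).closure

variable {V : Type*} [Quiver V] [Fintype (Quiver.Total V)]

/-- The restriction of the Hamiltonian to `Dom(H₀) ∩ H^𝒢`. -/
def hamiltonianRed (B : InvariantInner E G) (c : Quiver.Total V → ℝ) :
    L2 G (Quiver.Total V) →ₗ.[ℂ] L2 G (Quiver.Total V) :=
  (hamiltonian B c).domRestrict (gaugeInvariant V G)

end Hamiltonian

end LatticeGauge

end

/-! On smooth functions the theorem is an identity of differential operators,
`electricOp_comp_config`. If the edge `x` lies on the path refining `e`, then R(a)_e = A a_x T with
T the product over the edges after `x`. Replacing a_x by a_x h multiplies R(a)_e on the right by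
T⁻¹hT and changes no other coordinate. So the field X at `x`, applied to f ∘ R, becomes Ad(T⁻¹)X at
`e`, applied to f. As T does not involve a_x, the same holds for second derivatives.

An isometry Ad(T⁻¹) takes dual bases to dual bases and the Casimir element does not see the choice
of basis, so Δ_x(f ∘ R) = (Δ_e f) ∘ R (`edgeLaplacian_comp`). Edges on no path contribute zero, and
the constants along the path of `e` add up to I_e.

To pass to closures, integration by parts makes the operators symmetric on a dense domain, hence
closable, and a bounded operator that maps one graph into another maps the closed graphs likewise
(`closure_intertwine`). A gauge transformation also acts on each edge by right translation up to
conjugation, so the same argument (`hamiltonian_intertwine`) shows that H₀ commutes with every U(g)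
and preserves gauge invariance. The reduced statement follows by restriction. -/

noncomputable section

namespace LatticeGauge

/-! ### Basis independence of the Casimir element. -/

section Casimir

/-- The element `∑ₖ bₖ ⊗ b^k` does not depend on the choice of the pair of dual families. -/
lemma sum_dual_family {n : Type*} [Fintype n] {κ : Type*} [Fintype κ]
    {L M : Type*} [AddCommGroup L] [Module ℝ L] [AddCommGroup M] [Module ℝ M]
    {B : LinearMap.BilinForm ℝ L} (hB : B.Nondegenerate) (hs : ∀ x y, B x y = B y x)
    [DecidableEq n] (b : Module.Basis n ℝ L) {c d : κ → L} (hcd : ∀ x, ∑ i, B x (d i) • c i = x)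
    (T : L →ₗ[ℝ] L →ₗ[ℝ] M) :
    ∑ i, T (c i) (d i) = ∑ k, T (b k) (B.dualBasis hB b k) := by
  have hd : ∀ x, ∑ l, B x (b l) • B.dualBasis hB b l = x := fun x => by
    simpa using (B.dualBasis hB b).sum_repr x
  -- Expand each `d i` in the dual basis, move the coefficients to the first slot, and contract
  -- there with `hcd` at `b l`.
  calc ∑ i, T (c i) (d i) = ∑ i, ∑ l, B (b l) (d i) • T (c i) (B.dualBasis hB b l) := by
        refine Finset.sum_congr rfl fun i _ => ?_
        conv_lhs => rw [← hd (d i)]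
        simp [hs (d i)]
    _ = ∑ l, T (∑ i, B (b l) (d i) • c i) (B.dualBasis hB b l) := by
        rw [Finset.sum_comm]
        simp
    _ = _ := by simp [hcd]

end Casimir

/-! ### Derivatives and Laplacians under maps that act on one edge by conjugated translation. -/

section ChainRule

variable {E : Type*} [NormedAddCommGroup E] [NormedSpace ℝ E]
  {G : Type*} [TopologicalSpace G] [ChartedSpace E G] [Group G]

lemma lieDeriv_const (X : GroupLieAlgebra 𝓘(ℝ, E) G) (z : ℂ) :
    lieDeriv X (fun _ : G => z) = fun _ => 0 := by
  funext g
  simp only [lieDeriv]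
  rw [mfderiv_const]
  rfl

lemma edgeDeriv_add_left {ι : Type*} (e : ι) (X Y : GroupLieAlgebra 𝓘(ℝ, E) G)
    (f : (ι → G) → ℂ) (a : ι → G) :
    edgeDeriv e (X + Y) f a = edgeDeriv e X f a + edgeDeriv e Y f a := by
  simp only [edgeDeriv, lieDeriv, mulInvariantVectorField_add, Pi.add_apply]
  exact map_add _ _ _

lemma edgeDeriv_smul_left {ι : Type*} (e : ι) (t : ℝ) (X : GroupLieAlgebra 𝓘(ℝ, E) G)
    (f : (ι → G) → ℂ) (a : ι → G) :
    edgeDeriv e (t • X) f a = t • edgeDeriv e X f a := by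
  simp only [edgeDeriv, lieDeriv, mulInvariantVectorField_smul, Pi.smul_apply]
  exact map_smul _ _ _

open Classical in
lemma edgeLaplacian_eq_zero [FiniteDimensional ℝ E] {ι : Type*} (B : InvariantInner E G)
    {f : (ι → G) → ℂ} {e : ι} {a : ι → G} (h : ∀ g, f (Function.update a e g) = f a) :
    edgeLaplacian B e f a = 0 := by
  simp [edgeLaplacian, laplacian, h, lieDeriv_const]

lemma sum_form_dualBasis [FiniteDimensional ℝ E] (B : InvariantInner E G)
    (X : GroupLieAlgebra 𝓘(ℝ, E) G) :
    ∑ k, B.form X (Module.finBasis ℝ (GroupLieAlgebra 𝓘(ℝ, E) G) k) •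
      B.form.dualBasis B.nondegenerate (Module.finBasis ℝ (GroupLieAlgebra 𝓘(ℝ, E) G)) k = X := by
  simpa using (B.form.dualBasis B.nondegenerate
    (Module.finBasis ℝ (GroupLieAlgebra 𝓘(ℝ, E) G))).sum_repr X

lemma sum_form_dualBasis_right [FiniteDimensional ℝ E] (B : InvariantInner E G)
    (X : GroupLieAlgebra 𝓘(ℝ, E) G) :
    ∑ k, B.form X (B.form.dualBasis B.nondegenerate
      (Module.finBasis ℝ (GroupLieAlgebra 𝓘(ℝ, E) G)) k) •
        Module.finBasis ℝ (GroupLieAlgebra 𝓘(ℝ, E) G) k = X := by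
  have h := B.form.dualBasis_dualBasis B.nondegenerate ⟨B.symm⟩
    (Module.finBasis ℝ (GroupLieAlgebra 𝓘(ℝ, E) G))
  have h' := (B.form.dualBasis B.nondegenerate (B.form.dualBasis B.nondegenerate
    (Module.finBasis ℝ (GroupLieAlgebra 𝓘(ℝ, E) G)))).sum_repr X
  simp only [LinearMap.BilinForm.dualBasis_repr_apply] at h'
  rwa [h] at h'

/-- Preserving a positive definite form forces injectivity, and finite dimension does the rest;
multiplicativity of `Ad` is not needed. -/
lemma Ad_surjective [FiniteDimensional ℝ E] (B : InvariantInner E G) (p : G) :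
    Function.Surjective (Ad E p) := by
  have hinj : Function.Injective (Ad E p).toLinearMap := by
    rw [← LinearMap.ker_eq_bot, LinearMap.ker_eq_bot']
    intro X hX
    by_contra h
    have h1 := B.ad_invariant p X X
    have h2 : Ad E p X = 0 := hX
    rw [h2] at h1
    simp only [map_zero] at h1
    exact (B.pos X h).ne h1
  exact LinearMap.injective_iff_surjective.1 hinj

/-- Conjugation carries a dual pair of bases to a dual pair. This is how invariance of the inner
product enters the comparison of Laplacians. -/
lemma sum_form_Ad [FiniteDimensional ℝ E] (B : InvariantInner E G) (p : G)
    (X : GroupLieAlgebra 𝓘(ℝ, E) G) :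
    ∑ k, B.form X (Ad E p (B.form.dualBasis B.nondegenerate
      (Module.finBasis ℝ (GroupLieAlgebra 𝓘(ℝ, E) G)) k)) •
        Ad E p (Module.finBasis ℝ (GroupLieAlgebra 𝓘(ℝ, E) G) k) = X := by
  obtain ⟨Y, rfl⟩ := Ad_surjective B p X
  simp only [B.ad_invariant]
  conv_rhs => rw [← sum_form_dualBasis_right B Y]
  simp only [map_sum, map_smul]

variable {ι κ : Type*} [Fintype ι] [Fintype κ] [LieGroup 𝓘(ℝ, E) ∞ G]

/-- The second derivative `X Y f` in the variable `e` as a bilinear map. -/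
def edgeHessian (e : ι) {f : (ι → G) → ℂ} (hf : f ∈ smoothFunctions ι E G) (a : ι → G) :
    GroupLieAlgebra 𝓘(ℝ, E) G →ₗ[ℝ] GroupLieAlgebra 𝓘(ℝ, E) G →ₗ[ℝ] ℂ :=
  LinearMap.mk₂ ℝ (fun X Y => edgeDeriv e X (edgeDeriv e Y f) a)
    (fun _ _ _ => edgeDeriv_add_left _ _ _ _ _)
    (fun _ _ _ => edgeDeriv_smul_left _ _ _ _ _)
    (fun X Y Z => by
      have : edgeDeriv e (Y + Z) f = edgeDeriv e Y f + edgeDeriv e Z f :=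
        funext fun _ => edgeDeriv_add_left _ _ _ _ _
      rw [this, edgeDeriv_add e X (smooth_edgeDeriv e Y hf) (smooth_edgeDeriv e Z hf)]
      rfl)
    (fun t X Y => by
      have : edgeDeriv e (t • Y) f = (t : ℂ) • edgeDeriv e Y f :=
        funext fun _ => edgeDeriv_smul_left _ _ _ _ _
      rw [this, edgeDeriv_smul e X _ (smooth_edgeDeriv e Y hf)]
      rfl)

/-- Frees the Laplacian from the basis fixed in its definition: below it is expanded in conjugated
bases and in a dual pair with the order reversed. -/
lemma edgeLaplacian_eq_sum [FiniteDimensional ℝ E] (B : InvariantInner E G) (e : ι)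
    {f : (ι → G) → ℂ} (hf : f ∈ smoothFunctions ι E G) (a : ι → G) {n : Type*} [Fintype n]
    {c d : n → GroupLieAlgebra 𝓘(ℝ, E) G} (hcd : ∀ X, ∑ i, B.form X (d i) • c i = X) :
    edgeLaplacian B e f a = ∑ i, edgeDeriv e (c i) (edgeDeriv e (d i) f) a := by
  rw [edgeLaplacian_eq]
  exact (sum_dual_family B.nondegenerate B.symm _ hcd (edgeHessian e hf a)).symm

open Classical in
/-- The chain rule for a map `Φ` of configuration spaces under which right translation by `g` in
the variable `x` corresponds to right translation by `p g p⁻¹` in the variable `e`. -/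
lemma edgeDeriv_comp {Φ : (κ → G) → (ι → G)} {x : κ} {e : ι} {f : (ι → G) → ℂ}
    (hf : f ∈ smoothFunctions ι E G) (hfΦ : f ∘ Φ ∈ smoothFunctions κ E G) {a : κ → G} {p : G}
    (h : ∀ g, Φ (Function.update a x (a x * g)) =
      Function.update (Φ a) e (Φ a e * (p * g * p⁻¹)))
    (X : GroupLieAlgebra 𝓘(ℝ, E) G) :
    edgeDeriv x X (f ∘ Φ) a = edgeDeriv e (Ad E p X) f (Φ a) := by
  rw [edgeDeriv_eq x X hfΦ, edgeDeriv_eq e _ hf]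
  have h0 : (fun g => (f ∘ Φ) (Function.update a x (a x * g))) =
      fun g => f (Function.update (Φ a) e (Φ a e * (p * g * p⁻¹))) := funext fun g => by
    simp only [Function.comp_apply, h]
  refine (congrArg (fun φ : G → ℂ => (show E →L[ℝ] ℂ from mfderiv 𝓘(ℝ, E) 𝓘(ℝ, ℂ) φ 1)
    (show E from X)) h0).trans ?_
  have h1 : MDifferentiableAt 𝓘(ℝ, E) 𝓘(ℝ, ℂ)
      (fun g => f (Function.update (Φ a) e (Φ a e * g))) (p * 1 * p⁻¹) :=
    ((smooth_slice e hf (Φ a)).comp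
      (contMDiff_mul_left (I := 𝓘(ℝ, E)) (n := ∞) (a := Φ a e))).mdifferentiable (by simp) _
  have h2 : MDifferentiableAt 𝓘(ℝ, E) 𝓘(ℝ, E) (fun g : G => p * g * p⁻¹) 1 :=
    ((contMDiff_mul_right (I := 𝓘(ℝ, E)) (n := ∞) (a := p⁻¹)).comp
      (contMDiff_mul_left (I := 𝓘(ℝ, E)) (n := ∞) (a := p))).mdifferentiable (by simp) _
  have h3 := mfderiv_comp (1 : G) h1 h2
  change mfderiv 𝓘(ℝ, E) 𝓘(ℝ, ℂ)
    (fun g => f (Function.update (Φ a) e (Φ a e * (p * g * p⁻¹)))) 1 = _ at h3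
  refine (congrArg (fun D : E →L[ℝ] ℂ => D (show E from X)) h3).trans ?_
  change mfderiv 𝓘(ℝ, E) 𝓘(ℝ, ℂ) (fun g => f (Function.update (Φ a) e (Φ a e * g)))
    (p * 1 * p⁻¹) (Ad E p X) = _
  -- The chain rule places the outer derivative at the image of 1 under conjugation, which is 1 only
  -- propositionally.
  have h4 : p * 1 * p⁻¹ = 1 := by simp
  rw [h4]

-- The hypothesis covers the whole slice through `a` in the variable `x`, with one `p` for all `k`.
-- Hence `Ad E p Y` stays constant along the slice and the first-order chain rule can be applied
-- twice.
open Classical in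
lemma edgeLaplacian_comp [FiniteDimensional ℝ E] (B : InvariantInner E G)
    {Φ : (κ → G) → (ι → G)} {x : κ} {e : ι} {f : (ι → G) → ℂ}
    (hΦ : ∀ f ∈ smoothFunctions ι E G, f ∘ Φ ∈ smoothFunctions κ E G)
    (hf : f ∈ smoothFunctions ι E G) {a : κ → G} {p : G}
    (h : ∀ k g, Φ (Function.update a x (k * g)) =
      Function.update (Φ (Function.update a x k)) e
        (Φ (Function.update a x k) e * (p * g * p⁻¹))) :
    edgeLaplacian B x (f ∘ Φ) a = edgeLaplacian B e f (Φ a) := by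
  have h1 : ∀ {f : (ι → G) → ℂ}, f ∈ smoothFunctions ι E G → ∀ X k,
      edgeDeriv x X (f ∘ Φ) (Function.update a x k) =
        edgeDeriv e (Ad E p X) f (Φ (Function.update a x k)) := fun hf X k =>
    edgeDeriv_comp hf (hΦ _ hf) (fun g => by simpa using h k g) X
  have h2 : ∀ X Y, edgeDeriv x X (edgeDeriv x Y (f ∘ Φ)) a =
      edgeDeriv e (Ad E p X) (edgeDeriv e (Ad E p Y) f) (Φ a) := by
    intro X Y
    have h3 := h1 (smooth_edgeDeriv e (Ad E p Y) hf) X (a x)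
    rw [Function.update_eq_self] at h3
    rw [← h3]
    exact congrArg (fun φ : G → ℂ => lieDeriv X φ (a x)) (funext (h1 hf Y))
  rw [edgeLaplacian_eq_sum B e hf (Φ a) (sum_form_Ad B p), edgeLaplacian_eq]
  exact Finset.sum_congr rfl fun k _ => h2 _ _

end ChainRule

/-! ### Integration by parts and symmetry on smooth functions. -/

section IntegrationByParts

variable {ι : Type*} [Fintype ι]
  {E : Type*} [NormedAddCommGroup E] [NormedSpace ℝ E]
  {G : Type*} [TopologicalSpace G] [ChartedSpace E G]

lemma continuous_of_smooth {f : (ι → G) → ℂ} (hf : f ∈ smoothFunctions ι E G) : Continuous f :=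
  ContMDiff.continuous (I := configModel ι E) (I' := 𝓘(ℝ, ℂ)) (n := ∞) hf

variable [Group G]

-- By left invariance, a left translate of an integral curve is again an integral curve, so a single
-- curve serves every starting point `a`.
open Classical in
lemma hasDerivAt_comp_integralCurve [LieGroup 𝓘(ℝ, E) ∞ G] (e : ι)
    (X : GroupLieAlgebra 𝓘(ℝ, E) G) {f : (ι → G) → ℂ} (hf : f ∈ smoothFunctions ι E G)
    (a : ι → G) {γ : ℝ → G} {t : ℝ}
    (hγ : HasMFDerivAt 𝓘(ℝ, ℝ) 𝓘(ℝ, E) γ t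
      ((1 : ℝ →L[ℝ] ℝ).smulRight (mulInvariantVectorField X (γ t)))) :
    HasDerivAt (fun s => f (Function.update a e (a e * γ s)))
      (edgeDeriv e X f (Function.update a e (a e * γ t))) t := by
  have hψ : ContMDiff 𝓘(ℝ, E) 𝓘(ℝ, ℂ) ∞ (fun g => f (Function.update a e (a e * g))) :=
    (smooth_slice e hf a).comp (contMDiff_mul_left (I := 𝓘(ℝ, E)) (n := ∞) (a := a e))
  let D : E →L[ℝ] ℂ :=
    mfderiv 𝓘(ℝ, E) 𝓘(ℝ, ℂ) (fun g => f (Function.update a e (a e * g))) (γ t)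
  let v : E := mulInvariantVectorField X (γ t)
  have h1 : HasFDerivAt (fun s => f (Function.update a e (a e * γ s)))
      (D.comp ((1 : ℝ →L[ℝ] ℝ).smulRight v)) t :=
    hasMFDerivAt_iff_hasFDerivAt.1
      ((hψ.mdifferentiable (by simp) (γ t)).hasMFDerivAt.comp t hγ)
  have h3 : edgeDeriv e X f (Function.update a e (a e * γ t)) = D v := by
    rw [edgeDeriv_eq e X hf]
    have h4 : MDifferentiableAt 𝓘(ℝ, E) 𝓘(ℝ, ℂ)
        (fun g => f (Function.update a e (a e * g))) (γ t * 1) :=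
      hψ.mdifferentiable (by simp) _
    have h5 : MDifferentiableAt 𝓘(ℝ, E) 𝓘(ℝ, E) (fun g : G => γ t * g) 1 :=
      (contMDiff_mul_left (I := 𝓘(ℝ, E)) (n := ∞)).mdifferentiable (by simp) _
    have h6 := mfderiv_comp (1 : G) h4 h5
    have h7 : (fun g => f (Function.update (Function.update a e (a e * γ t)) e
        (Function.update a e (a e * γ t) e * g))) =
        (fun g => f (Function.update a e (a e * g))) ∘ fun g => γ t * g :=
      funext fun g => by simp [mul_assoc]
    refine (congrArg (fun φ : G → ℂ => (show E →L[ℝ] ℂ from mfderiv 𝓘(ℝ, E) 𝓘(ℝ, ℂ) φ 1)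
      (show E from X)) h7).trans ?_
    refine (congrArg (fun D : E →L[ℝ] ℂ => D (show E from X)) h6).trans ?_
    change mfderiv 𝓘(ℝ, E) 𝓘(ℝ, ℂ) (fun g => f (Function.update a e (a e * g))) (γ t * 1) _ = _
    rw [mul_one]
    rfl
  rw [h3]
  simpa using h1.hasDerivAt

/-- A local flow line through 1 replaces the exponential map: only derivatives near time 0 are
needed. -/
lemma exists_integralCurve [FiniteDimensional ℝ E] [LieGroup 𝓘(ℝ, E) ∞ G]
    (X : GroupLieAlgebra 𝓘(ℝ, E) G) :
    ∃ γ : ℝ → G, γ 0 = 1 ∧ ∀ᶠ t in nhds 0, HasMFDerivAt 𝓘(ℝ, ℝ) 𝓘(ℝ, E) γ t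
      ((1 : ℝ →L[ℝ] ℝ).smulRight (mulInvariantVectorField X (γ t))) := by
  have h3 : LieGroup 𝓘(ℝ, E) (minSmoothness ℝ 3) G := by
    rw [minSmoothness_of_isRCLikeNormedField]
    exact LieGroup.of_le (n := ∞) (ENat.LEInfty.out)
  have hM : IsManifold 𝓘(ℝ, E) 1 G := IsManifold.of_le (n := ∞) (m := 1) (by simp)
  have : CompleteSpace E := FiniteDimensional.complete ℝ E
  have hX := contMDiff_mulInvariantVectorField X
  exact exists_isMIntegralCurveAt_of_contMDiffAt_boundaryless 0
    ((hX 1).of_le (by rw [minSmoothness_of_isRCLikeNormedField]; norm_num))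

lemma smooth_edgeLaplacian [FiniteDimensional ℝ E] [LieGroup 𝓘(ℝ, E) ∞ G]
    (B : InvariantInner E G) (e : ι)
    {f : (ι → G) → ℂ} (hf : f ∈ smoothFunctions ι E G) :
    edgeLaplacian B e f ∈ smoothFunctions ι E G := by
  rw [edgeLaplacian_eq]
  convert Submodule.sum_mem _ (fun k (_ : k ∈ Finset.univ) => smooth_edgeDeriv e
    (Module.finBasis ℝ (GroupLieAlgebra 𝓘(ℝ, E) G) k) (smooth_edgeDeriv e
      (B.form.dualBasis B.nondegenerate (Module.finBasis ℝ (GroupLieAlgebra 𝓘(ℝ, E) G)) k) hf))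
    using 1
  funext a
  simp

variable [IsTopologicalGroup G] [CompactSpace G] [MeasurableSpace G] [BorelSpace G]

open Classical in
lemma measurePreserving_update_mul (e : ι) (g : G) :
    MeasurePreserving (fun a : ι → G => Function.update a e (a e * g))
      (configMeasure G ι) (configMeasure G ι) := by
  have h := measurePreserving_pi (fun _ : ι => haarProb G) (fun _ => haarProb G)
    (f := fun e' x => x * Function.update (1 : ι → G) e g e') fun e' =>
      measurePreserving_mul_right (haarProb G) _
  have h' : (fun a : ι → G => Function.update a e (a e * g)) =
      fun a e' => a e' * Function.update (1 : ι → G) e g e' := by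
    funext a e'
    by_cases he : e' = e
    · subst he; simp
    · simp [he]
  rw [h']
  exact h

variable [SecondCountableTopology G]

lemma integrable_of_continuous {f : (ι → G) → ℂ} (hf : Continuous f) :
    Integrable f (configMeasure G ι) :=
  hf.integrable_of_hasCompactSupport (HasCompactSupport.of_compactSpace f)

open Classical in
/-- The integral of a derivative along right translations vanishes. -/
lemma integral_eq_zero_of_hasDerivAt (e : ι) {f f' : (ι → G) → ℂ} (hf : Continuous f)
    (hf' : Continuous f') {γ : ℝ → G} (h0 : γ 0 = 1)
    (h : ∀ᶠ t in nhds 0, ∀ a, HasDerivAt (fun s => f (Function.update a e (a e * γ s)))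
      (f' (Function.update a e (a e * γ t))) t) :
    ∫ a, f' a ∂(configMeasure G ι) = 0 := by
  -- Compactness gives the constant dominating function for differentiating under the integral.
  obtain ⟨C, hC⟩ := isCompact_univ.exists_bound_of_continuousOn hf'.continuousOn
  have hmul : ∀ g : G, Continuous fun a : ι → G => Function.update a e (a e * g) := fun g =>
    continuous_id.update e ((continuous_apply e).mul continuous_const)
  have key := hasDerivAt_integral_of_dominated_loc_of_deriv_le (μ := configMeasure G ι)
    (F := fun t a => f (Function.update a e (a e * γ t)))
    (F' := fun t a => f' (Function.update a e (a e * γ t))) (bound := fun _ => C) (x₀ := (0 : ℝ)) h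
    (Filter.Eventually.of_forall fun t => (hf.comp (hmul _)).aestronglyMeasurable)
    (integrable_of_continuous (hf.comp (hmul _))) (hf'.comp (hmul _)).aestronglyMeasurable
    (Filter.Eventually.of_forall fun a t _ => hC _ trivial) (integrable_const _)
    (Filter.Eventually.of_forall fun a t ht => ht a)
  -- Right invariance of Haar measure makes the integral independent of `t`, so its derivative at 0
  -- vanishes.
  have hconst : (fun t => ∫ a, f (Function.update a e (a e * γ t)) ∂(configMeasure G ι)) =
      fun _ => ∫ a, f a ∂(configMeasure G ι) := funext fun t => by
    have hm := measurePreserving_update_mul (ι := ι) e (γ t)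
    conv_rhs => rw [← hm.map_eq]
    exact (integral_map hm.measurable.aemeasurable hf.aestronglyMeasurable).symm
  have h2 := key.2
  rw [hconst] at h2
  have h3 := h2.unique (hasDerivAt_const _ _)
  simpa [h0] using h3

variable [FiniteDimensional ℝ E] [LieGroup 𝓘(ℝ, E) ∞ G]

open ComplexConjugate in
lemma integral_conj_mul_edgeDeriv (e : ι) (X : GroupLieAlgebra 𝓘(ℝ, E) G)
    {f h : (ι → G) → ℂ} (hf : f ∈ smoothFunctions ι E G) (hh : h ∈ smoothFunctions ι E G) :
    ∫ a, conj (f a) * edgeDeriv e X h a ∂(configMeasure G ι) =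
      -∫ a, conj (edgeDeriv e X f a) * h a ∂(configMeasure G ι) := by
  obtain ⟨γ, h0, hγ⟩ := exists_integralCurve X
  have cf := continuous_of_smooth hf
  have ch := continuous_of_smooth hh
  have cf' := continuous_of_smooth (smooth_edgeDeriv e X hf)
  have ch' := continuous_of_smooth (smooth_edgeDeriv e X hh)
  have c1 : Continuous fun a => conj (edgeDeriv e X f a) * h a :=
    (Complex.continuous_conj.comp cf').mul ch
  have c2 : Continuous fun a => conj (f a) * edgeDeriv e X h a :=
    (Complex.continuous_conj.comp cf).mul ch'
  -- Leibniz rule for the product, whose derivative has integral zero.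
  have key := integral_eq_zero_of_hasDerivAt e (f := fun a => conj (f a) * h a)
    (f' := fun a => conj (edgeDeriv e X f a) * h a + conj (f a) * edgeDeriv e X h a)
    ((Complex.continuous_conj.comp cf).mul ch) (c1.add c2) h0 <| by
      filter_upwards [hγ] with t ht a
      exact (hasDerivAt_comp_integralCurve e X hf a ht).star.mul
        (hasDerivAt_comp_integralCurve e X hh a ht)
  rw [integral_add (integrable_of_continuous c1) (integrable_of_continuous c2)] at key
  exact eq_neg_of_add_eq_zero_right key

open ComplexConjugate in
lemma integral_conj_mul_edgeLaplacian (B : InvariantInner E G) (e : ι)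
    {f h : (ι → G) → ℂ} (hf : f ∈ smoothFunctions ι E G) (hh : h ∈ smoothFunctions ι E G) :
    ∫ a, conj (f a) * edgeLaplacian B e h a ∂(configMeasure G ι) =
      ∫ a, conj (edgeLaplacian B e f a) * h a ∂(configMeasure G ι) := by
  -- Two integrations by parts reverse the order of the two fields, so the Laplacians of `f` and `h`
  -- are expanded in the dual pair in opposite orders and the terms match one by one.
  have h1 : ∀ a, edgeLaplacian B e f a = _ := fun a =>
    edgeLaplacian_eq_sum B e hf a (sum_form_dualBasis B)
  have h2 : ∀ a, edgeLaplacian B e h a = _ := fun a =>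
    edgeLaplacian_eq_sum B e hh a (sum_form_dualBasis_right B)
  simp only [h1, h2, Finset.mul_sum, map_sum, Finset.sum_mul]
  have hD : ∀ {f : (ι → G) → ℂ} (X Y : GroupLieAlgebra 𝓘(ℝ, E) G),
      f ∈ smoothFunctions ι E G → Continuous (edgeDeriv e X (edgeDeriv e Y f)) :=
    fun X Y hf => continuous_of_smooth (smooth_edgeDeriv e X (smooth_edgeDeriv e Y hf))
  rw [integral_finsetSum, integral_finsetSum]
  · refine Finset.sum_congr rfl fun k _ => ?_
    rw [integral_conj_mul_edgeDeriv e _ hf (smooth_edgeDeriv e _ hh),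
      integral_conj_mul_edgeDeriv e _ (smooth_edgeDeriv e _ hf) hh, neg_neg]
  · exact fun k _ => integrable_of_continuous
      ((Complex.continuous_conj.comp (hD _ _ hf)).mul (continuous_of_smooth hh))
  · exact fun k _ => integrable_of_continuous
      ((Complex.continuous_conj.comp (continuous_of_smooth hf)).mul (hD _ _ hh))

open ComplexConjugate in
lemma integral_conj_mul_electricOp (B : InvariantInner E G) (c : ι → ℝ)
    {f h : (ι → G) → ℂ} (hf : f ∈ smoothFunctions ι E G) (hh : h ∈ smoothFunctions ι E G) :
    ∫ a, conj (f a) * electricOp B c h a ∂(configMeasure G ι) =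
      ∫ a, conj (electricOp B c f a) * h a ∂(configMeasure G ι) := by
  have cf := continuous_of_smooth hf
  have ch := continuous_of_smooth hh
  simp only [electricOp, Finset.mul_sum, map_sum, Finset.sum_mul]
  rw [integral_finsetSum, integral_finsetSum]
  rotate_left
  · exact fun e _ => integrable_of_continuous
      ((Complex.continuous_conj.comp
        (continuous_const.mul (continuous_of_smooth (smooth_edgeLaplacian B e hf)))).mul ch)
  · exact fun e _ => integrable_of_continuous
      ((Complex.continuous_conj.comp cf).mul
        (continuous_const.mul (continuous_of_smooth (smooth_edgeLaplacian B e hh))))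
  refine Finset.sum_congr rfl fun e _ => ?_
  have h1 : ∀ a, conj (f a) * (-(1 / 2 : ℂ) * (c e : ℂ) * edgeLaplacian B e h a) =
      (-(1 / 2 : ℂ) * (c e : ℂ)) * (conj (f a) * edgeLaplacian B e h a) := fun a => by ring
  have h2 : ∀ a, conj (-(1 / 2 : ℂ) * (c e : ℂ) * edgeLaplacian B e f a) * h a =
      (-(1 / 2 : ℂ) * (c e : ℂ)) * (conj (edgeLaplacian B e f a) * h a) := fun a => by
    simp [mul_assoc, map_ofNat (starRingEnd ℂ) 2]
  simp only [h1, h2]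
  rw [integral_const_mul, integral_const_mul, integral_conj_mul_edgeLaplacian B e hf hh]

end IntegrationByParts

/-! ### Closable operators, their closures, and density of smooth functions. -/

section Closability

/-- An operator with dense domain that is symmetric is closable. -/
lemma isClosable_of_symmetric {H : Type*} [NormedAddCommGroup H] [InnerProductSpace ℂ H]
    {T : H →ₗ.[ℂ] H} (hd : Dense (T.domain : Set H))
    (hs : ∀ x y : T.domain, inner ℂ (x : H) (T y) = inner ℂ (T x) (y : H)) : T.IsClosable := by
  -- For fixed `x` the symmetry relation is a closed condition, so it survives in the closure of the
  -- graph; there a point (0, w) has w orthogonal to the dense domain.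
  have hcl : ∀ z ∈ T.graph.topologicalClosure, ∀ x : T.domain,
      inner ℂ (x : H) z.2 = inner ℂ (T x) z.1 := by
    intro z hz x
    have hC : IsClosed {z : H × H | inner ℂ (x : H) z.2 = inner ℂ (T x) z.1} :=
      isClosed_eq (by fun_prop) (by fun_prop)
    refine hC.closure_subset_iff.2 ?_ hz
    rintro ⟨y, w⟩ hyw
    obtain ⟨y', rfl, rfl⟩ := (T.mem_graph_iff).1 hyw
    exact hs x y'
  refine ⟨T.graph.topologicalClosure.toLinearPMap, ?_⟩
  rw [Submodule.toLinearPMap_graph_eq]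
  intro z hz hz0
  refine hd.eq_zero_of_inner_right ℂ fun x hx => ?_
  rw [hcl z hz ⟨x, hx⟩, hz0, inner_zero_right]

/-- A bounded operator that intertwines two closable operators intertwines their closures. -/
lemma closure_intertwine {H K : Type*} [NormedAddCommGroup H] [NormedSpace ℂ H]
    [NormedAddCommGroup K] [NormedSpace ℂ K] {T : H →ₗ.[ℂ] H} {S : K →ₗ.[ℂ] K}
    (hT : T.IsClosable) (hS : S.IsClosable) (u : H →L[ℂ] K)
    (h : ∀ z ∈ T.graph, (u z.1, u z.2) ∈ S.graph) (x : T.closure.domain) :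
    ∃ hx : u x ∈ S.closure.domain, S.closure ⟨u x, hx⟩ = u (T.closure x) := by
  have hz : ((x : H), T.closure x) ∈ T.graph.topologicalClosure := by
    rw [hT.graph_closure_eq_closure_graph]
    exact T.closure.mem_graph x
  have h1 : (u x, u (T.closure x)) ∈ S.closure.graph := by
    rw [← hS.graph_closure_eq_closure_graph]
    exact map_mem_closure (f := fun z : H × H => (u z.1, u z.2)) (by fun_prop) hz h
  obtain ⟨y, hy, hy'⟩ := (S.closure.mem_graph_iff).1 h1
  have hy : (y : K) = u x := hy
  have hx : u x ∈ S.closure.domain := hy ▸ y.2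
  have hyx : y = ⟨u x, hx⟩ := Subtype.ext hy
  exact ⟨hx, hyx ▸ hy'⟩

variable {ι : Type*} [Fintype ι]
  {E : Type*} [NormedAddCommGroup E] [NormedSpace ℝ E]
  {G : Type*} [TopologicalSpace G] [ChartedSpace E G] [Group G] [IsTopologicalGroup G]
  [CompactSpace G] [MeasurableSpace G] [BorelSpace G] [SecondCountableTopology G]

lemma coeFn_smoothToL2 (f : smoothFunctions ι E G) :
    smoothToL2 ι E G f =ᵐ[configMeasure G ι] f.1 :=
  ContinuousMap.coeFn_toLp _ _

lemma inner_smoothToL2 (f h : smoothFunctions ι E G) :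
    inner ℂ (smoothToL2 ι E G f) (smoothToL2 ι E G h) =
      ∫ a, star (f.1 a) * h.1 a ∂(configMeasure G ι) := by
  rw [L2.inner_def]
  refine integral_congr_ae ?_
  filter_upwards [coeFn_smoothToL2 f, coeFn_smoothToL2 h] with a h1 h2
  rw [h1, h2, RCLike.inner_apply, mul_comm]
  rfl

lemma compMeasurePreserving_smoothToL2 {κ : Type*} [Fintype κ]
    {Φ : (κ → G) → (ι → G)} (hΦ : MeasurePreserving Φ (configMeasure G κ) (configMeasure G ι))
    (f : smoothFunctions ι E G) (hf : f.1 ∘ Φ ∈ smoothFunctions κ E G) :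
    Lp.compMeasurePreservingₗᵢ ℂ Φ hΦ (smoothToL2 ι E G f) = smoothToL2 κ E G ⟨f.1 ∘ Φ, hf⟩ := by
  apply Lp.ext
  exact (Lp.coeFn_compMeasurePreserving _ hΦ).trans
    ((hΦ.quasiMeasurePreserving.ae_eq_comp (coeFn_smoothToL2 f)).trans
      (coeFn_smoothToL2 (⟨f.1 ∘ Φ, hf⟩ : smoothFunctions κ E G)).symm)

variable [FiniteDimensional ℝ E] [LieGroup 𝓘(ℝ, E) ∞ G]

lemma denseRange_smoothToL2 [T2Space G] : DenseRange (smoothToL2 ι E G) := by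
  let _ := TopologicalSpace.metrizableSpaceMetric (ι → G)
  have h1 : DenseRange (ContinuousMap.toLp 2 (configMeasure G ι) ℂ : C(ι → G, ℂ) →L[ℂ] L2 G ι) :=
    ContinuousMap.toLp_denseRange ℂ (configMeasure G ι) ℂ (by simp)
  refine h1.comp (g := ContinuousMap.toLp 2 (configMeasure G ι) ℂ)
    (f := fun f : smoothFunctions ι E G => (⟨f.1, continuous_of_smooth f.2⟩ : C(ι → G, ℂ)))
    ?_ (ContinuousLinearMap.continuous _)
  rw [Metric.denseRange_iff]
  intro φ ε hε
  -- Uniform smooth approximation, with ε/2 so that the supremum distance is strictly below ε.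
  obtain ⟨g, hg, -⟩ := φ.continuous.exists_contMDiff_approx (configModel ι E) ⊤
    (continuous_const (y := ε / 2)) fun _ => half_pos hε
  refine ⟨⟨g, g.contMDiff⟩, ?_⟩
  refine lt_of_le_of_lt ((ContinuousMap.dist_le (half_pos hε).le).2 fun a => ?_) (half_lt_self hε)
  rw [dist_comm]
  exact (hg a).le

lemma mem_graph_smoothHamiltonian (B : InvariantInner E G) (c : ι → ℝ) {z : L2 G ι × L2 G ι} :
    z ∈ (smoothHamiltonian B c).graph ↔ ∃ f : smoothFunctions ι E G,
      smoothToL2 ι E G f = z.1 ∧ smoothToL2 ι E G (electricMap B c f) = z.2 := by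
  rw [LinearPMap.mem_graph_iff]
  have h : ∀ f : smoothFunctions ι E G, ∀ hf,
      smoothHamiltonian B c ⟨smoothToL2 ι E G f, hf⟩ = smoothToL2 ι E G (electricMap B c f) := by
    intro f hf
    have : (LinearEquiv.ofInjective (smoothToL2 ι E G) smoothToL2_injective).symm
        ⟨smoothToL2 ι E G f, hf⟩ = f :=
      (LinearEquiv.symm_apply_eq _).2 (Subtype.ext rfl)
    exact congrArg (fun f => smoothToL2 ι E G (electricMap B c f)) this
  constructor
  · rintro ⟨⟨_, f, rfl⟩, h1, h2⟩
    exact ⟨f, h1, (h f _).symm.trans h2⟩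
  · rintro ⟨f, h1, h2⟩
    exact ⟨⟨smoothToL2 ι E G f, f, rfl⟩, h1, (h f _).trans h2⟩

lemma isClosable_smoothHamiltonian [T2Space G] (B : InvariantInner E G) (c : ι → ℝ) :
    (smoothHamiltonian B c).IsClosable := by
  refine isClosable_of_symmetric ?_ fun x y => ?_
  · exact denseRange_smoothToL2
  · obtain ⟨f, h1, h2⟩ := (mem_graph_smoothHamiltonian B c).1 (LinearPMap.mem_graph _ x)
    obtain ⟨h, h3, h4⟩ := (mem_graph_smoothHamiltonian B c).1 (LinearPMap.mem_graph _ y)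
    simp only at h1 h2 h3 h4
    rw [← h1, ← h2, ← h3, ← h4, inner_smoothToL2, inner_smoothToL2]
    exact integral_conj_mul_electricOp B c f.2 h.2

end Closability

/-! ### Effect of gauge transformations and refinements on a translation of one edge. -/

section Translations

variable {V W : Type*} [Quiver V] [Quiver W] {G : Type*} [Group G]

lemma map_update_of_notMem {ι M : Type*} [DecidableEq ι] {l : List ι} {x : ι} (hx : x ∉ l)
    (a : ι → M) (k : M) : l.map (Function.update a x k) = l.map a :=
  List.map_congr_left fun y hy => by
    have : y ≠ x := fun h => hx (h ▸ hy)
    simp [this]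

-- Here the conjugating element is the gauge value at the target of `e`, which passes from the right
-- of `h` to both sides.
open Classical in
lemma gaugeAct_update (g : V → G) (a : Quiver.Total V → G) (e : Quiver.Total V) (k h : G) :
    gaugeAct g (Function.update a e (k * h)) =
      Function.update (gaugeAct g (Function.update a e k)) e
        (gaugeAct g (Function.update a e k) e * (g e.right * h * (g e.right)⁻¹)) := by
  funext e'
  by_cases he : e' = e
  · subst he
    simp [gaugeAct, mul_assoc]
  · simp [gaugeAct, he]

open Classical in
lemma config_update_of_notMem (r : Refinement V W) (a : Quiver.Total W → G) {x : Quiver.Total W}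
    (hx : ∀ e, x ∉ r.path e) (k : G) : r.config (Function.update a x k) = r.config a :=
  funext fun e => by simp only [Refinement.config, map_update_of_notMem (hx e)]

lemma eq_of_mem_path (r : Refinement V W) {x : Quiver.Total W} {e e' : Quiver.Total V}
    (h : x ∈ r.path e) (h' : x ∈ r.path e') : e = e' := by
  by_contra hne
  exact r.edges_disjoint e e' hne h h'

-- The element `p` is the inverse of the product over the edges after `x`. Since the path meets `x`
-- only once, `p` does not depend on `k`; since paths are disjoint, no other coordinate moves.
open Classical in
lemma exists_config_update (r : Refinement V W) (a : Quiver.Total W → G) {x : Quiver.Total W}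
    {e : Quiver.Total V} (hx : x ∈ r.path e) :
    ∃ p : G, ∀ k h, r.config (Function.update a x (k * h)) =
      Function.update (r.config (Function.update a x k)) e
        (r.config (Function.update a x k) e * (p * h * p⁻¹)) := by
  obtain ⟨l₁, l₂, hl⟩ := List.append_of_mem hx
  have hn : (r.path e).Nodup := r.edges_nodup e
  rw [hl, List.nodup_middle, List.nodup_cons, List.mem_append, not_or] at hn
  refine ⟨((l₂.map a).prod)⁻¹, fun k h => funext fun e' => ?_⟩
  by_cases he : e' = e
  · subst he
    simp [Refinement.config, hl, map_update_of_notMem hn.1.1, map_update_of_notMem hn.1.2,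
      mul_assoc]
  · have hx' : x ∉ r.path e' := fun h' => he (eq_of_mem_path r h' hx)
    simp [Refinement.config, he, map_update_of_notMem hx']

end Translations

/-! ### Intertwining of the differential operators on smooth functions. -/

section Intertwining

variable {V W : Type*} [Quiver V] [Quiver W]
  [Fintype (Quiver.Total V)] [Fintype (Quiver.Total W)]
  {E : Type*} [NormedAddCommGroup E] [NormedSpace ℝ E]
  {G : Type*} [TopologicalSpace G] [ChartedSpace E G] [Group G] [LieGroup 𝓘(ℝ, E) ∞ G]

lemma contMDiff_prod_map_list {ι : Type*} [Fintype ι] (l : List ι) :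
    ContMDiff (configModel ι E) 𝓘(ℝ, E) ∞ (fun a : ι → G => (l.map a).prod) := by
  induction l with
  | nil => simpa using contMDiff_const
  | cons x l ih =>
    simp only [List.map_cons, List.prod_cons]
    exact (contMDiff_eval ∞ x).mul ih

lemma smooth_comp_config (r : Refinement V W) {f : (Quiver.Total V → G) → ℂ}
    (hf : f ∈ smoothFunctions (Quiver.Total V) E G) :
    f ∘ r.config ∈ smoothFunctions (Quiver.Total W) E G :=
  ContMDiff.comp (I' := configModel (Quiver.Total V) E) hf
    (contMDiff_into_config fun e => contMDiff_prod_map_list (r.path e))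

lemma smooth_comp_gaugeAct (g : V → G) {f : (Quiver.Total V → G) → ℂ}
    (hf : f ∈ smoothFunctions (Quiver.Total V) E G) :
    f ∘ gaugeAct g ∈ smoothFunctions (Quiver.Total V) E G :=
  ContMDiff.comp (I' := configModel (Quiver.Total V) E) hf
    (contMDiff_into_config fun e =>
      (contMDiff_const.mul (contMDiff_eval ∞ e)).mul contMDiff_const)

variable [FiniteDimensional ℝ E]

lemma electricOp_comp_gaugeAct (B : InvariantInner E G) (c : Quiver.Total V → ℝ) (g : V → G)
    {f : (Quiver.Total V → G) → ℂ} (hf : f ∈ smoothFunctions (Quiver.Total V) E G) :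
    electricOp B c (f ∘ gaugeAct g) = electricOp B c f ∘ gaugeAct g := by
  funext a
  refine Finset.sum_congr rfl fun e _ => ?_
  rw [edgeLaplacian_comp B (fun _ => smooth_comp_gaugeAct g) hf (gaugeAct_update g a e)]

lemma electricOp_comp_config (B : InvariantInner E G) (r : Refinement V W)
    {I : Quiver.Total V → ℝ} {J : Quiver.Total W → ℝ} (hIJ : ∀ e, I e = ((r.path e).map J).sum)
    {f : (Quiver.Total V → G) → ℂ} (hf : f ∈ smoothFunctions (Quiver.Total V) E G) :
    electricOp B J (f ∘ r.config) = electricOp B I f ∘ (r.config) := by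
  classical
  funext a
  -- At most one `e` has `x` on its path, so the sum over `e` has at most one nonzero term; with no
  -- such `e`, the function is constant in `a x`.
  have h1 : ∀ x, -(1 / 2 : ℂ) * (J x : ℂ) * edgeLaplacian B x (f ∘ r.config) a =
      ∑ e, if x ∈ r.path e then
        -(1 / 2 : ℂ) * (J x : ℂ) * edgeLaplacian B e f (r.config a) else 0 := by
    intro x
    by_cases hx : ∃ e, x ∈ r.path e
    · obtain ⟨e, he⟩ := hx
      obtain ⟨p, hp⟩ := exists_config_update r a he
      rw [Finset.sum_eq_single e _ (by simp), if_pos he,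
        edgeLaplacian_comp B (fun _ => smooth_comp_config r) hf hp]
      intro e' _ hne
      exact if_neg fun h => hne (eq_of_mem_path r h he)
    · push Not at hx
      rw [edgeLaplacian_eq_zero B fun g => by
        simp only [Function.comp_apply, config_update_of_notMem r a hx]]
      simp [hx]
  have h2 : ∀ e, ∑ x, (if x ∈ r.path e then
      -(1 / 2 : ℂ) * (J x : ℂ) * edgeLaplacian B e f (r.config a) else 0) =
      -(1 / 2 : ℂ) * (I e : ℂ) * edgeLaplacian B e f (r.config a) := by
    intro e
    -- The path has no repeated edge, so no multiplicity is lost in passing to a finite set.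
    have h3 : I e = ∑ x ∈ (r.path e).toFinset, J x := by
      rw [hIJ]
      exact (List.sum_toFinset J (r.edges_nodup e)).symm
    have h4 : (Finset.univ.filter fun x => x ∈ r.path e) = (r.path e).toFinset := by
      ext x
      simp
    rw [← Finset.sum_filter, h4, h3, ← Finset.sum_mul, ← Finset.mul_sum]
    push_cast
    rfl
  simp only [electricOp, Function.comp_apply, h1]
  rw [Finset.sum_comm]
  exact Finset.sum_congr rfl fun e _ => h2 e

end Intertwining

/-! ### Passage to the closed Hamiltonians and gauge reduction. -/

section Hamiltonian

variable {V W : Type*} [Quiver V] [Quiver W]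
  [Fintype (Quiver.Total V)] [Fintype (Quiver.Total W)]
  {E : Type*} [NormedAddCommGroup E] [NormedSpace ℝ E] [FiniteDimensional ℝ E]
  {G : Type*} [TopologicalSpace G] [ChartedSpace E G] [Group G] [LieGroup 𝓘(ℝ, E) ∞ G]
  [IsTopologicalGroup G] [CompactSpace G] [SecondCountableTopology G]
  [MeasurableSpace G] [BorelSpace G]

/-- A measure preserving map that intertwines the differential operators on smooth functions
intertwines the Hamiltonians. -/
lemma hamiltonian_intertwine [T2Space G] {ι κ : Type*} [Fintype ι] [Fintype κ]
    (B : InvariantInner E G) {c : ι → ℝ} {d : κ → ℝ} {Φ : (κ → G) → (ι → G)}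
    (hΦ : MeasurePreserving Φ (configMeasure G κ) (configMeasure G ι))
    (hs : ∀ f ∈ smoothFunctions ι E G, f ∘ Φ ∈ smoothFunctions κ E G)
    (he : ∀ f ∈ smoothFunctions ι E G, electricOp B d (f ∘ Φ) = electricOp B c f ∘ Φ)
    (ψ : (hamiltonian B c).domain) :
    ∃ h : Lp.compMeasurePreservingₗᵢ ℂ Φ hΦ (ψ : L2 G ι) ∈ (hamiltonian B d).domain,
      hamiltonian B d ⟨Lp.compMeasurePreservingₗᵢ ℂ Φ hΦ (ψ : L2 G ι), h⟩ =
        Lp.compMeasurePreservingₗᵢ ℂ Φ hΦ (hamiltonian B c ψ) := by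
  refine closure_intertwine (isClosable_smoothHamiltonian B c) (isClosable_smoothHamiltonian B d)
    (Lp.compMeasurePreservingₗᵢ ℂ Φ hΦ).toContinuousLinearMap ?_ ψ
  rintro ⟨x, y⟩ hz
  obtain ⟨f, h1, h2⟩ := (mem_graph_smoothHamiltonian B c).1 hz
  refine (mem_graph_smoothHamiltonian B d).2 ⟨⟨f.1 ∘ Φ, hs _ f.2⟩, ?_, ?_⟩
  · rw [← compMeasurePreserving_smoothToL2 hΦ f, h1]
    rfl
  · have h3 : electricMap B d ⟨f.1 ∘ Φ, hs _ f.2⟩ =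
        (⟨(electricMap B c f).1 ∘ Φ, hs _ (electricMap B c f).2⟩ : smoothFunctions κ E G) :=
      Subtype.ext (he f.1 f.2)
    rw [h3, ← compMeasurePreserving_smoothToL2 hΦ, h2]
    rfl

/-- Each U(g) commutes with H₀, so U(g)ψ = ψ gives U(g)H₀ψ = H₀U(g)ψ = H₀ψ. -/
lemma hamiltonian_mem_gaugeInvariant [T2Space G] (B : InvariantInner E G)
    (c : Quiver.Total V → ℝ) (ψ : (hamiltonian B c).domain)
    (hψ : (ψ : L2 G (Quiver.Total V)) ∈ gaugeInvariant V G) :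
    hamiltonian B c ψ ∈ gaugeInvariant V G := by
  rw [mem_gaugeInvariant] at hψ ⊢
  intro g
  obtain ⟨h, h'⟩ := hamiltonian_intertwine B (measurePreserving_gaugeAct g)
    (fun _ => smooth_comp_gaugeAct g) (fun _ => electricOp_comp_gaugeAct B c g) ψ
  refine h'.symm.trans ?_
  exact congrArg (hamiltonian B c) (Subtype.ext (hψ g))

lemma hamiltonianRed_apply (B : InvariantInner E G) (c : Quiver.Total V → ℝ)
    (ψ : (hamiltonianRed B c).domain) :
    hamiltonianRed B c ψ = hamiltonian B c ⟨ψ, (Submodule.mem_inf.1 ψ.2).2⟩ :=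
  LinearPMap.domRestrict_apply rfl

lemma hamiltonianRed_mem_gaugeInvariant [T2Space G] (B : InvariantInner E G)
    (c : Quiver.Total V → ℝ) (ψ : (hamiltonianRed B c).domain) :
    hamiltonianRed B c ψ ∈ gaugeInvariant V G := by
  rw [hamiltonianRed_apply]
  exact hamiltonian_mem_gaugeInvariant B c _ (Submodule.mem_inf.1 ψ.2).1

lemma hamiltonian_u [T2Space G] (B : InvariantInner E G) (r : Refinement V W)
    {I : Quiver.Total V → ℝ} {J : Quiver.Total W → ℝ} (hIJ : ∀ e, I e = ((r.path e).map J).sum)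
    (ψ : (hamiltonian B I).domain) :
    ∃ h : r.u G ψ ∈ (hamiltonian B J).domain,
      hamiltonian B J ⟨r.u G ψ, h⟩ = r.u G (hamiltonian B I ψ) :=
  hamiltonian_intertwine B r.measurePreserving_config (fun _ => smooth_comp_config r)
    (fun _ => electricOp_comp_config B r hIJ) ψ

end Hamiltonian

end LatticeGauge

end

theorem mainTheorem4
    {E : Type*} [NormedAddCommGroup E] [NormedSpace ℝ E] [FiniteDimensional ℝ E]
    {G : Type*} [TopologicalSpace G] [ChartedSpace E G] [Group G] [LieGroup 𝓘(ℝ, E) ∞ G]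
    [IsTopologicalGroup G] [CompactSpace G] [T2Space G] [SecondCountableTopology G]
    [MeasurableSpace G] [BorelSpace G]
    (B : LatticeGauge.InvariantInner E G)
    {V W : Type*} [Quiver V] [Quiver W]
    [Fintype (Quiver.Total V)] [Fintype (Quiver.Total W)]
    (r : LatticeGauge.Refinement V W)
    (I : Quiver.Total V → ℝ) (J : Quiver.Total W → ℝ)
    (hIJ : ∀ e, I e = ((r.path e).map J).sum) :
    -- the differential operators have closures, so that the Hamiltonians are well defined
    ((LatticeGauge.smoothHamiltonian B I).IsClosable ∧
      (LatticeGauge.smoothHamiltonian B J).IsClosable) ∧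
    -- `u` maps the domain into the domain and intertwines the Hamiltonians
    (∀ ψ : (LatticeGauge.hamiltonian B I).domain,
      ∃ h : r.u G ψ ∈ (LatticeGauge.hamiltonian B J).domain,
        LatticeGauge.hamiltonian B J ⟨r.u G ψ, h⟩ = r.u G (LatticeGauge.hamiltonian B I ψ)) ∧
    -- the restrictions are operators on the gauge invariant subspaces, and the restriction of `u`
    -- maps the domain into the domain and intertwines them
    (∃ (hI : ∀ ψ, LatticeGauge.hamiltonianRed B I ψ ∈ LatticeGauge.gaugeInvariant V G)
      (hJ : ∀ ψ, LatticeGauge.hamiltonianRed B J ψ ∈ LatticeGauge.gaugeInvariant W G),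
      ∀ (ψ : LatticeGauge.gaugeInvariant V G)
        (hψ : (ψ : LatticeGauge.L2 G (Quiver.Total V)) ∈ (LatticeGauge.hamiltonianRed B I).domain),
        ∃ h : (r.uRed G ψ : LatticeGauge.L2 G (Quiver.Total W)) ∈
            (LatticeGauge.hamiltonianRed B J).domain,
          (⟨LatticeGauge.hamiltonianRed B J ⟨r.uRed G ψ, h⟩, hJ _⟩ :
              LatticeGauge.gaugeInvariant W G) =
            r.uRed G ⟨LatticeGauge.hamiltonianRed B I ⟨ψ, hψ⟩, hI _⟩) := by
  refine ⟨⟨LatticeGauge.isClosable_smoothHamiltonian B I,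
    LatticeGauge.isClosable_smoothHamiltonian B J⟩, LatticeGauge.hamiltonian_u B r hIJ,
    LatticeGauge.hamiltonianRed_mem_gaugeInvariant B I,
    LatticeGauge.hamiltonianRed_mem_gaugeInvariant B J, fun ψ hψ => ?_⟩
  obtain ⟨h, h'⟩ := LatticeGauge.hamiltonian_u B r hIJ ⟨ψ, (Submodule.mem_inf.1 hψ).2⟩
  -- The reduced objects have the same underlying vectors as the full ones, so the unreduced
  -- identity suffices.
  refine ⟨Submodule.mem_inf.2 ⟨(r.uRed G ψ).2, h⟩, Subtype.ext ?_⟩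
  exact (LatticeGauge.hamiltonianRed_apply B J _).trans (h'.trans
    (congrArg (r.u G) (LatticeGauge.hamiltonianRed_apply B I ⟨ψ, hψ⟩).symm))
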